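/- For an integer $m\ge 2$ let $\mathrm D=\mathrm D(\mathbb C^m)$ be the set of quantum states on $\mathbb C^m$, that is, of all positive semidefinite Hermitian complex $m\times m$ matrices of trace $1$. It is a convex body in the real affine space $H$ of Hermitian $m\times m$ matrices of trace $1$, which has dimension $m^2-1$. Take the maximally mixed state $\rho_*=\mathrm{Id}/m$ as the origin of $H$, so that for $t\ge 0$ the dilate of $\mathrm D$ is $t\bullet \mathrm D=\{t\rho+(1-t)\rho_* : \rho\in \mathrm D\}$. Let $$\dim_V(\mathrm D)=\log\inf\{N : \text{there is a convex polytope } P \text{ with } N \text{ vertices such that } \mathrm D\subset P\subset 4\bullet \mathrm D\}$$ be the verticial dimension of $\mathrm D$, and let $$\dim_F(\mathrm D)=\log\inf\{N : \text{there is a convex polytope } Q \text{ with } N \text{ facets such that } \mathrm D\subset Q\subset 4\bullet \mathrm D\}$$ be its facial dimension, where facets are faces of dimension $m^2-2$. Then $$\dim_F(\mathrm D(\mathbb C^m))=\dim_V(\mathrm D(\mathbb C^m))=\Theta(m);$$ that is, the two dimensions are equal for every $m\ge 2$, and there are absolute constants $c,C>0$ such that $c\,m\le \dim_V(\mathrm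 D(\mathbb C^m))\le C\,m$ for all $m\ge 2$. -/

import Mathlib

open scoped ComplexOrder

/-- A (convex) polytope: the convex hull of a finite set of points. -/
def IsPolytope {E : Type*} [AddCommGroup E] [Module ℝ E] (P : Set E) : Prop :=
  ∃ s : Set E, s.Finite ∧ P = convexHull ℝ s

/-- The vertices of a polytope are its extreme points. -/
def vertexSet {E : Type*} [AddCommGroup E] [Module ℝ E] (P : Set E) : Set E :=
  Set.extremePoints ℝ P

/-- `F` is a facet of `P`: a nonempty (exposed) face of `P` whose dimension is one less than the
dimension of `P`, the dimension of a set being that of its affine span. -/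
def IsFacet {E : Type*} [AddCommGroup E] [Module ℝ E] [TopologicalSpace E] (P F : Set E) : Prop :=
  F.Nonempty ∧ IsExposed ℝ P F ∧
    Module.finrank ℝ (vectorSpan ℝ F) + 1 = Module.finrank ℝ (vectorSpan ℝ P)

/-- The set of facets of `P`. -/
def facetSet {E : Type*} [AddCommGroup E] [Module ℝ E] [TopologicalSpace E] (P : Set E) :
    Set (Set E) :=
  {F | IsFacet P F}

/-- The verticial dimension `dim_V(K, A)` of a convex body `K`, where the point `o` plays the
role of the origin: `A K` is the image of `K` under `x ↦ o + A (x - o)`. The body `K` is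
full-dimensional in its affine span, which contains `o`; a set `P` with `K ⊆ P ⊆ A K` has the same
affine span, so that it does not matter in which larger space this span is placed. -/
noncomputable def verticialDim {E : Type*} [AddCommGroup E] [Module ℝ E]
    (o : E) (K : Set E) (A : ℝ) : ℝ :=
  Real.log (sInf {N : ℕ | ∃ P : Set E, IsPolytope P ∧ (vertexSet P).encard = N ∧
    K ⊆ P ∧ P ⊆ AffineMap.homothety o A '' K} : ℕ)

/-- The facial dimension `dim_F(K, A)` of a convex body `K`, where the point `o` plays the role of
the origin. The facets of a polytope `Q` with `K ⊆ Q ⊆ A K` are its faces of codimension one in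
the common affine span of `K` and `Q`. -/
noncomputable def facialDim {E : Type*} [AddCommGroup E] [Module ℝ E] [TopologicalSpace E]
    (o : E) (K : Set E) (A : ℝ) : ℝ :=
  Real.log (sInf {N : ℕ | ∃ Q : Set E, IsPolytope Q ∧ (facetSet Q).encard = N ∧
    K ⊆ Q ∧ Q ⊆ AffineMap.homothety o A '' K} : ℕ)

/-- The set `D(ℂ^m)` of quantum states: positive semidefinite (in particular Hermitian) complex
matrices of trace one. -/
def quantumStates (m : ℕ) : Set (Matrix (Fin m) (Fin m) ℂ) :=
  {ρ | ρ.PosSemidef ∧ ρ.trace = 1}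

/-- The maximally mixed state `ρ_* = Id / m`. -/
noncomputable def maximallyMixed (m : ℕ) : Matrix (Fin m) (Fin m) ℂ :=
  (m : ℂ)⁻¹ • (1 : Matrix (Fin m) (Fin m) ℂ)

/-! The positive semidefinite cone is self-dual for the trace form, so the polar of `D` about `ρ_*`
with respect to `-(m/4) Re tr(XY)` is `4 • D`, and the polar of `4 • D` is `D`. Polarity therefore
maps polytopes between `D` and `4 • D` to polytopes of the same kind, and neither direction between
vertices and facets increases the count. Hence the two dimensions agree
(`facialDim_eq_verticialDim`).

For the upper bound, take the pure states of the nonzero integer vectors in `ℤ^{2m}` of `ℓ¹` norm at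
most `4m`; there are at most `2^{4m} 3^{2m}` of them. A vector `x` with `‖x‖² = m` is an average of
such integer vectors (randomised rounding of its coordinates), and the covariance of the rounding is
dominated by a multiple of the identity. So `|x⟩⟨x| + 3 Id` lies in the cone they generate
(`dyad_add_mem_of_rounding`). Rescaling and summing gives `ρ + 3ρ_*` in the cone for every state
`ρ`; comparing traces, `D` lies in the dilate by 4 of the hull of these pure states.

For the lower bound, use the `2^m` functionals `ρ ↦ ⟨ε|ρ|ε⟩` with `ε` a sign vector. Each has
maximum `m` on `D`, so some vertex of `P`, contracted by 4 into `D`, has value at least `m/4`. On a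
fixed state the value is the squared norm of a Rademacher sum of total variance 1, whose exponential
moment is bounded (`sum_exp_norm_rademacher_sq_le`). A single vertex thus serves only an
exponentially small fraction of the signs (`exp_le_of_polytope_between`). -/

open Filter Topology

/-! ### Polarity of polytopes: exchanging vertices and facets. -/

section Duality

variable {M : Type*} [AddCommGroup M] [Module ℝ M]

/-- The polar of `V` inside the affine space `o + W`, with respect to the bilinear form `B`. -/
def polarIn (B : LinearMap.BilinForm ℝ M) (o : M) (W : Submodule ℝ M) (V : Set M) : Set M :=
  {x | x - o ∈ W ∧ ∀ v ∈ V, B (v - o) (x - o) ≤ 1}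

/-- Room to move: a direction `g` that vanishes on the active constraints can be followed a little
both ways without leaving the polyhedron. -/
lemma exists_pos_forall_add_mul_abs_le {ι : Type*} {V : Set ι} (hV : V.Finite) {f g : ι → ℝ}
    (h : ∀ v ∈ V, f v < 1 ∨ (f v = 1 ∧ g v = 0)) :
    ∃ t : ℝ, 0 < t ∧ ∀ v ∈ V, f v + t * |g v| ≤ 1 := by
  have key : ∀ᶠ t : ℝ in 𝓝[>] 0, ∀ v ∈ V, f v + t * |g v| ≤ 1 := by
    rw [Filter.eventually_all_finite hV]
    intro v hv
    rcases h v hv with h1 | ⟨h1, h2⟩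
    · have hc : Tendsto (fun t : ℝ => f v + t * |g v|) (𝓝[>] 0) (𝓝 (f v + 0 * |g v|)) := by
        apply Tendsto.mono_left _ nhdsWithin_le_nhds
        exact (Continuous.tendsto (by fun_prop) 0)
      filter_upwards [hc.eventually_lt_const (by simpa using h1)] with t ht
      exact ht.le
    · exact Eventually.of_forall fun t => by simp [h1, h2]
  obtain ⟨t, ht, ht'⟩ := (key.and self_mem_nhdsWithin).exists
  exact ⟨t, ht', ht⟩

variable {B : LinearMap.BilinForm ℝ M} {o : M} {W : Submodule ℝ M}

lemma polarIn_convexHull (V : Set M) : polarIn B o W (convexHull ℝ V) = polarIn B o W V := by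
  ext x
  refine and_congr_right fun _ => ⟨fun h v hv => h v (subset_convexHull ℝ V hv), fun h => ?_⟩
  have hconv : Convex ℝ {v : M | B (v - o) (x - o) ≤ 1} := by
    intro a ha b hb s t hs ht hst
    simp only [Set.mem_ofPred_eq] at *
    have : s • a + t • b - o = s • (a - o) + t • (b - o) := by
      rw [eq_sub_of_add_eq hst]; module
    rw [this]
    simp only [map_add, map_smul, LinearMap.add_apply, LinearMap.smul_apply, smul_eq_mul]
    nlinarith
  exact convexHull_min h hconv

lemma convex_polarIn (V : Set M) : Convex ℝ (polarIn B o W V) := by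
  intro a ha b hb s t hs ht hst
  have : s • a + t • b - o = s • (a - o) + t • (b - o) := by
    rw [eq_sub_of_add_eq hst]; module
  refine ⟨?_, fun v hv => ?_⟩
  · rw [this]
    exact W.add_mem (W.smul_mem _ ha.1) (W.smul_mem _ hb.1)
  · have h1 := ha.2 v hv
    have h2 := hb.2 v hv
    rw [this]
    simp only [map_add, map_smul, smul_eq_mul]
    nlinarith

lemma add_sub_mem_polarIn {V : Set M} {x z : M} {t : ℝ} (ht : 0 < t) (hx : x ∈ polarIn B o W V)
    (hz : z ∈ W) (h : ∀ v ∈ V, B (v - o) (x - o) + t * |B (v - o) z| ≤ 1) :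
    x + t • z ∈ polarIn B o W V ∧ x - t • z ∈ polarIn B o W V := by
  have e1 : x + t • z - o = (x - o) + t • z := by abel
  have e2 : x - t • z - o = (x - o) - t • z := by abel
  refine ⟨⟨?_, fun v hv => ?_⟩, ⟨?_, fun v hv => ?_⟩⟩
  · rw [e1]; exact W.add_mem hx.1 (W.smul_mem _ hz)
  · rw [e1, map_add, map_smul, smul_eq_mul]
    have := h v hv
    nlinarith [le_abs_self (B (v - o) z)]
  · rw [e2]; exact W.sub_mem hx.1 (W.smul_mem _ hz)
  · rw [e2, map_sub, map_smul, smul_eq_mul]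
    have := h v hv
    nlinarith [neg_abs_le (B (v - o) z)]

/-- The active constraints at an extreme point of a polyhedron have trivial annihilator. -/
lemma eq_zero_of_mem_extremePoints_polarIn {V : Set M} (hV : V.Finite) {x z : M}
    (hx : x ∈ (polarIn B o W V).extremePoints ℝ) (hz : z ∈ W)
    (h : ∀ v ∈ V, B (v - o) (x - o) = 1 → B (v - o) z = 0) : z = 0 := by
  obtain ⟨t, ht, ht'⟩ := exists_pos_forall_add_mul_abs_le hV
    (f := fun v => B (v - o) (x - o)) (g := fun v => B (v - o) z) (fun v hv => by
      rcases (hx.1.2 v hv).lt_or_eq with h1 | h1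
      · exact Or.inl h1
      · exact Or.inr ⟨h1, h v hv h1⟩)
  obtain ⟨h1, h2⟩ := add_sub_mem_polarIn ht hx.1 hz ht'
  have := (mem_extremePoints.1 hx).2 _ h1 _ h2
    ⟨1 / 2, 1 / 2, by norm_num, by norm_num, by norm_num, by module⟩
  have h3 : t • z = 0 := by simpa using this.1
  exact (smul_eq_zero.1 h3).resolve_left ht.ne'

/-- An extreme point is determined by its set of active constraints, a subset of the finite set `V`.
-/
lemma finite_extremePoints_polarIn {V : Set M} (hV : V.Finite) :
    ((polarIn B o W V).extremePoints ℝ).Finite := by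
  refine Set.Finite.of_finite_image (f := fun x => {v ∈ V | B (v - o) (x - o) = 1})
    (hV.finite_subsets.subset ?_) ?_
  · rintro _ ⟨x, -, rfl⟩
    exact Set.sep_subset _ _
  · intro x hx y hy hxy
    have hd : x - y = 0 := by
      refine eq_zero_of_mem_extremePoints_polarIn hV hx (z := x - y) ?_ fun v hv h1 => ?_
      · have := W.sub_mem hx.1.1 hy.1.1
        simpa using this
      · have h2 : v ∈ {v ∈ V | B (v - o) (y - o) = 1} := by
          rw [← show _ = {v ∈ V | B (v - o) (y - o) = 1} from hxy]; exact ⟨hv, h1⟩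
        have : x - y = (x - o) - (y - o) := by abel
        rw [this, map_sub, h1, h2.2, sub_self]
    exact sub_eq_zero.1 hd

lemma vectorSpan_eq_of_absorbing {K : Set M} (hKW : ∀ x ∈ K, x - o ∈ W) (ho : o ∈ K)
    (habs : ∀ z ∈ W, ∃ t : ℝ, 0 < t ∧ o + t • z ∈ K) : vectorSpan ℝ K = W := by
  apply le_antisymm
  · rw [vectorSpan_def, Submodule.span_le]
    rintro _ ⟨x, hx, y, hy, rfl⟩
    have := W.sub_mem (hKW x hx) (hKW y hy)
    simpa using this
  · intro z hz
    obtain ⟨t, ht, h⟩ := habs z hz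
    have h1 := vsub_mem_vectorSpan ℝ h ho
    have h2 : t • z ∈ vectorSpan ℝ K := by simpa using h1
    have h3 := (vectorSpan ℝ K).smul_mem t⁻¹ h2
    rwa [smul_smul, inv_mul_cancel₀ ht.ne', one_smul] at h3

lemma encard_le_natCast_of_injOn {α β : Type*} {s : Set α} {t : Set β} {N : ℕ} (ht : t.encard = N)
    (f : α → β) (hf : Set.MapsTo f s t) (hi : Set.InjOn f s) :
    ∃ N' : ℕ, N' ≤ N ∧ s.encard = N' := by
  have h : s.encard ≤ N := by
    rw [← hi.encard_image, ← ht]; exact Set.encard_le_encard hf.image_subset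
  have hfin : s.encard ≠ ⊤ := ne_top_of_le_ne_top (by simp) h
  obtain ⟨n, hn⟩ := ENat.ne_top_iff_exists.1 hfin
  exact ⟨n, by rw [← hn] at h; exact_mod_cast h, hn.symm⟩

lemma mem_homothety_image_iff {K : Set M} {A : ℝ} (hA : 0 < A) {x : M} :
    x ∈ AffineMap.homothety o A '' K ↔ o + A⁻¹ • (x - o) ∈ K := by
  constructor
  · rintro ⟨y, hy, rfl⟩
    simpa [AffineMap.homothety_apply, smul_smul, inv_mul_cancel₀ hA.ne'] using hy
  · intro h
    refine ⟨_, h, ?_⟩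
    simp [AffineMap.homothety_apply, smul_smul, mul_inv_cancel₀ hA.ne']

/-- By `hK` the polar of `K` is the dilate of `K` by `A`, and conversely; polarity reverses
inclusions, so it preserves the sandwich. -/
lemma polarIn_between {K P : Set M} {A : ℝ} (hA : 0 < A)
    (hKW : ∀ x ∈ K, x - o ∈ W)
    (hK : ∀ x, x - o ∈ W → (x ∈ K ↔ ∀ y ∈ K, A * B (y - o) (x - o) ≤ 1))
    (h1 : K ⊆ P) (h2 : P ⊆ AffineMap.homothety o A '' K) :
    K ⊆ polarIn B o W P ∧ polarIn B o W P ⊆ AffineMap.homothety o A '' K := by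
  constructor
  · intro x hx
    refine ⟨hKW x hx, fun v hv => ?_⟩
    have h3 := (mem_homothety_image_iff hA).1 (h2 hv)
    have h4 := (hK x (hKW x hx)).1 hx _ h3
    rwa [add_sub_cancel_left, map_smul, LinearMap.smul_apply, smul_eq_mul, ← mul_assoc,
      mul_inv_cancel₀ hA.ne', one_mul] at h4
  · intro x hx
    rw [mem_homothety_image_iff hA, hK _ (by simpa using W.smul_mem _ hx.1)]
    intro y hy
    rw [add_sub_cancel_left, map_smul, smul_eq_mul, ← mul_assoc, mul_inv_cancel₀ hA.ne', one_mul]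
    exact hx.2 y (h1 hy)

variable [TopologicalSpace M]

/-- A polar has at most as many facets as there are constraints. -/
lemma exists_encard_facetSet_polarIn [FiniteDimensional ℝ M] {V : Set M} (hV : V.Finite) {N : ℕ} (hN : V.encard = N)
    (hspan : vectorSpan ℝ (polarIn B o W V) = W) :
    ∃ N' : ℕ, N' ≤ N ∧ (facetSet (polarIn B o W V)).encard = N' := by
  set Q := polarIn B o W V with hQ
  have hsub : ∀ F : Set M, IsFacet Q F → F ⊆ Q := by
    rintro F ⟨hne, hex, -⟩
    exact (hex.isExtreme).subset
  have hv : ∀ F : Set M, IsFacet Q F → ∃ v ∈ V, ∀ x ∈ F, B (v - o) (x - o) = 1 := by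
    rintro F hF
    by_contra! hcon
    have hFQ := hsub F hF
    obtain ⟨hne, hex, hrank⟩ := hF
    have hcv : Convex ℝ F := hex.convex (convex_polarIn V)
    -- If no single constraint is tight on all of `F`, averaging points of `F` makes every
    -- constraint slack at once. The exposing functional then vanishes on `W`, so `F = Q`, against
    -- codimension one.
    obtain ⟨x, hxF, hx⟩ : ∃ x ∈ F, ∀ v ∈ V, B (v - o) (x - o) < 1 := by
      have : ∀ U : Set M, U.Finite → U ⊆ V → ∃ x ∈ F, ∀ v ∈ U, B (v - o) (x - o) < 1 := by
        intro U hU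
        induction U, hU using Set.Finite.induction_on with
        | empty => intro _; obtain ⟨x, hx⟩ := hne; exact ⟨x, hx, by simp⟩
        | insert _ _ ih =>
          rename_i a s _ _
          intro hs
          obtain ⟨x, hx, hx'⟩ := ih ((Set.subset_insert _ _).trans hs)
          obtain ⟨y, hy, hy'⟩ := hcon a (hs (Set.mem_insert _ _))
          refine ⟨(1 / 2 : ℝ) • x + (1 / 2 : ℝ) • y,
            hcv hx hy (by norm_num) (by norm_num) (by norm_num), fun v hv => ?_⟩
          have e : (1 / 2 : ℝ) • x + (1 / 2 : ℝ) • y - o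
              = (1 / 2 : ℝ) • (x - o) + (1 / 2 : ℝ) • (y - o) := by module
          rw [e, map_add, map_smul, map_smul, smul_eq_mul, smul_eq_mul]
          have hxv := (hFQ hx).2 v
          have hyv := (hFQ hy).2 v
          rcases hv with rfl | hv
          · have := hxv (hs (Set.mem_insert _ _))
            have := lt_of_le_of_ne (hyv (hs (Set.mem_insert _ _))) hy'
            linarith
          · have := hx' v hv
            have := hyv (hs (Set.mem_insert_of_mem _ hv))
            linarith
      exact this V hV subset_rfl
    obtain ⟨l, hl⟩ := hex hne
    have hl0 : ∀ z ∈ W, l z = 0 := by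
      intro z hz
      obtain ⟨t, ht, ht'⟩ := exists_pos_forall_add_mul_abs_le hV
        (f := fun v => B (v - o) (x - o)) (g := fun v => B (v - o) z)
        (fun v hv => Or.inl (hx v hv))
      obtain ⟨h1, h2⟩ := add_sub_mem_polarIn ht (hFQ hxF) hz ht'
      rw [hl] at hxF
      have h3 := hxF.2 _ h1
      have h4 := hxF.2 _ h2
      simp only [map_add, map_sub, map_smul, smul_eq_mul] at h3 h4
      have : t * l z = 0 := by linarith
      exact (mul_eq_zero.1 this).resolve_left ht.ne'
    have hFQ' : F = Q := by
      apply subset_antisymm hFQ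
      intro y hy
      rw [hl]
      refine ⟨hy, fun w hw => ?_⟩
      have h1 := hl0 _ (W.sub_mem hw.1 hy.1)
      have h2 : w - o - (y - o) = w - y := by abel
      rw [h2, map_sub] at h1
      linarith
    rw [hFQ'] at hrank
    omega
  choose! v hvV hv1 using hv
  refine encard_le_natCast_of_injOn hN v (fun F hF => hvV F hF) ?_
  have key : ∀ F F' : Set M, IsFacet Q F → IsFacet Q F' → v F = v F' → F' ⊆ F := by
    intro F F' hF hF' hvv y hy
    -- A facet fills the hyperplane of its tight constraint, so two facets sharing a constraint
    -- coincide.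
    have hspanF : vectorSpan ℝ F = W ⊓ LinearMap.ker (B (v F - o)) := by
      apply Submodule.eq_of_le_of_finrank_le
      · rw [vectorSpan_def, Submodule.span_le]
        rintro _ ⟨a, ha, b, hb, rfl⟩
        have e : a - b = (a - o) - (b - o) := by abel
        change a - b ∈ _
        rw [e]
        refine ⟨W.sub_mem (hsub F hF ha).1 (hsub F hF hb).1, ?_⟩
        rw [SetLike.mem_coe, LinearMap.mem_ker, map_sub, hv1 F hF a ha, hv1 F hF b hb, sub_self]
      · have hlt : W ⊓ LinearMap.ker (B (v F - o)) < W := by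
          refine lt_of_le_of_ne inf_le_left fun heq => ?_
          obtain ⟨a, ha⟩ := hF.1
          have h1 : a - o ∈ W := (hsub F hF ha).1
          rw [← heq] at h1
          have h2 := LinearMap.mem_ker.1 h1.2
          rw [hv1 F hF a ha] at h2
          exact one_ne_zero h2
        have h1 := Submodule.finrank_lt_finrank_of_lt hlt
        have h2 := hF.2.2
        rw [hspan] at h2
        omega
    obtain ⟨l, hl⟩ := hF.2.1 hF.1
    obtain ⟨a, ha⟩ := hF.1
    have hl0 : vectorSpan ℝ F ≤ LinearMap.ker (l : M →ₗ[ℝ] ℝ) := by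
      rw [vectorSpan_def, Submodule.span_le]
      rintro _ ⟨x, hx, x', hx', rfl⟩
      rw [hl] at hx hx'
      have h1 := hx.2 _ hx'.1
      have h2 := hx'.2 _ hx.1
      change l (x - x') = 0
      rw [map_sub]
      exact sub_eq_zero.2 (le_antisymm h2 h1)
    have hya : y - a ∈ vectorSpan ℝ F := by
      rw [hspanF]
      have e : y - a = (y - o) - (a - o) := by abel
      rw [e]
      refine ⟨W.sub_mem (hsub F' hF' hy).1 (hsub F hF ha).1, ?_⟩
      rw [SetLike.mem_coe, LinearMap.mem_ker, map_sub, hv1 F hF a ha, hvv, hv1 F' hF' y hy,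
        sub_self]
    have h0 : l (y - a) = 0 := hl0 hya
    rw [map_sub] at h0
    rw [hl] at ha ⊢
    refine ⟨hsub F' hF' hy, fun w hw => ?_⟩
    have := ha.2 w hw
    linarith
  intro F hF F' hF' hvv
  exact subset_antisymm (key F' F hF' hF hvv.symm) (key F F' hF hF' hvv)

variable [IsTopologicalAddGroup M] [ContinuousSMul ℝ M] [T2Space M]

lemma IsPolytope.eq_convexHull_vertexSet [LocallyConvexSpace ℝ M] {P : Set M} (hP : IsPolytope P) :
    (vertexSet P).Finite ∧ P = convexHull ℝ (vertexSet P) := by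
  obtain ⟨s, hs, rfl⟩ := hP
  have hf : (vertexSet (convexHull ℝ s)).Finite := hs.subset extremePoints_convexHull_subset
  refine ⟨hf, ?_⟩
  have h := closure_convexHull_extremePoints (hs.isCompact_convexHull ℝ) (convex_convexHull ℝ s)
  rw [← vertexSet, (hf.isCompact_convexHull ℝ).isClosed.closure_eq] at h
  exact h.symm

variable [FiniteDimensional ℝ M]

lemma isClosed_polarIn (V : Set M) : IsClosed (polarIn B o W V) := by
  have : polarIn B o W V = (fun x => x - o) ⁻¹' (W : Set M) ∩
      ⋂ v ∈ V, {x | B (v - o) (x - o) ≤ 1} := by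
    ext x; simp [polarIn]
  rw [this]
  refine IsClosed.inter (W.closed_of_finiteDimensional.preimage (by fun_prop)) ?_
  refine isClosed_biInter fun v _ => ?_
  have : Continuous (B (v - o)) := LinearMap.continuous_of_finiteDimensional _
  exact isClosed_le (by fun_prop) continuous_const

lemma isPolytope_polarIn [LocallyConvexSpace ℝ M] {V C : Set M} (hV : V.Finite) (hC : IsCompact C)
    (h : polarIn B o W V ⊆ C) : IsPolytope (polarIn B o W V) := by
  have hf := finite_extremePoints_polarIn (B := B) (o := o) (W := W) hV
  refine ⟨_, hf, ?_⟩
  have h := closure_convexHull_extremePoints (hC.of_isClosed_subset (isClosed_polarIn V) h)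
    (convex_polarIn V)
  rwa [(hf.isCompact_convexHull ℝ).isClosed.closure_eq, eq_comm] at h

/-- The polar of a polytope has at most as many vertices as the polytope has facets. -/
lemma exists_encard_vertexSet_polarIn (hsymm : ∀ x y, B x y = B y x)
    (hnd : ∀ x ∈ W, (∀ y ∈ W, B x y = 0) → x = 0) (hW : W ≠ ⊥) {s : Set M} (hs : s.Finite)
    (hspan : vectorSpan ℝ (convexHull ℝ s) = W) (hsW : ∀ x ∈ convexHull ℝ s, x - o ∈ W)
    {N : ℕ} (hN : (facetSet (convexHull ℝ s)).encard = N) :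
    ∃ N' : ℕ, N' ≤ N ∧ (vertexSet (polarIn B o W s)).encard = N' := by
  have hact : ∀ w ∈ vertexSet (polarIn B o W s), ∀ z ∈ W,
      (∀ v ∈ s, B (v - o) (w - o) = 1 → B (v - o) z = 0) → z = 0 :=
    fun w hw z hz h => eq_zero_of_mem_extremePoints_polarIn hs hw hz h
  refine encard_le_natCast_of_injOn hN (fun w => {x ∈ convexHull ℝ s | B (w - o) (x - o) = 1})
    ?_ ?_
  · intro w hw
    set F : Set M := {x ∈ convexHull ℝ s | B (w - o) (x - o) = 1} with hF
    have hwP : w ∈ polarIn B o W (convexHull ℝ s) := by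
      rw [polarIn_convexHull]; exact hw.1
    -- With no active constraint every `z ∈ W` would vanish; this is where `W ≠ ⊥` enters.
    obtain ⟨v₀, hv₀s, hv₀⟩ : ∃ v ∈ s, B (v - o) (w - o) = 1 := by
      by_contra! hcon
      apply hW
      rw [Submodule.eq_bot_iff]
      exact fun z hz => hact w hw z hz fun v hv h => absurd h (hcon v hv)
    have hv₀F : v₀ ∈ F := ⟨subset_convexHull ℝ s hv₀s, by rw [hsymm]; exact hv₀⟩
    refine ⟨⟨v₀, hv₀F⟩, fun _ => ⟨LinearMap.toContinuousLinearMap (B (w - o)), ?_⟩, ?_⟩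
    · ext x
      simp only [Set.mem_ofPred_eq, LinearMap.coe_toContinuousLinearMap']
      refine and_congr_right fun hx => ⟨fun h y hy => ?_, fun h => ?_⟩
      · have h1 := hwP.2 y hy
        rw [hsymm, map_sub] at h1
        rw [map_sub] at h
        linarith
      · apply le_antisymm
        · rw [hsymm]; exact hwP.2 x hx
        · have h1 := h v₀ hv₀F.1
          have h2 := hv₀F.2
          rw [map_sub] at h2 ⊢
          linarith
    · rw [hspan]
      apply le_antisymm
      · have hlt : vectorSpan ℝ F < W := by
          have hle : vectorSpan ℝ F ≤ W ⊓ LinearMap.ker (B (w - o)) := by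
            rw [vectorSpan_def, Submodule.span_le]
            rintro _ ⟨a, ha, b, hb, rfl⟩
            have e : a - b = (a - o) - (b - o) := by abel
            change a - b ∈ _
            rw [e]
            refine ⟨W.sub_mem (hsW a ha.1) (hsW b hb.1), ?_⟩
            rw [SetLike.mem_coe, LinearMap.mem_ker, map_sub, ha.2, hb.2, sub_self]
          refine lt_of_le_of_ne (hle.trans inf_le_left) fun heq => ?_
          have h1 : v₀ - o ∈ W := hsW _ hv₀F.1
          rw [← heq] at h1
          have h2 := LinearMap.mem_ker.1 (hle h1).2
          rw [hv₀F.2] at h2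
          exact one_ne_zero h2
        exact Submodule.finrank_lt_finrank_of_lt hlt
      -- Otherwise a functional that kills the right side but not `W` is represented, by
      -- nondegeneracy, by a nonzero `z ∈ W` annihilated by all active constraints, which is
      -- impossible at a vertex.
      · have hle : W ≤ Submodule.span ℝ {v₀ - o} ⊔ vectorSpan ℝ F := by
          by_contra hnle
          set U := Submodule.span ℝ {v₀ - o} ⊔ vectorSpan ℝ F with hU
          obtain ⟨a, haW, haU⟩ := SetLike.not_le_iff_exists.1 hnle
          obtain ⟨f, hfa, hfU⟩ := Submodule.exists_le_ker_of_notMem haU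
          let β : W →ₗ[ℝ] Module.Dual ℝ W := (B.domRestrict₁₂ W W)
          have hβ : Function.Injective β := by
            rw [← LinearMap.ker_eq_bot, LinearMap.ker_eq_bot']
            intro x hx
            apply Subtype.ext
            refine hnd x x.2 fun y hy => ?_
            exact congrArg (fun g => g ⟨y, hy⟩) hx
          have hβs : Function.Surjective β :=
            (LinearMap.injective_iff_surjective_of_finrank_eq_finrank
              (Subspace.dual_finrank_eq).symm).1 hβ
          obtain ⟨z, hz⟩ := hβs (f.comp W.subtype)
          have hz' : ∀ y ∈ W, B z y = f y := fun y hy =>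
            congrArg (fun g => g ⟨y, hy⟩) hz
          have hz0 : (z : M) = 0 := by
            refine hact w hw z z.2 fun v hv h1 => ?_
            have hvF : v ∈ F := ⟨subset_convexHull ℝ s hv, by rw [hsymm]; exact h1⟩
            have hvU : v - o ∈ U := by
              have e : v - o = (v₀ - o) + (v -ᵥ v₀) := by rw [vsub_eq_sub]; abel
              rw [e]
              exact Submodule.add_mem_sup (Submodule.mem_span_singleton_self _)
                (vsub_mem_vectorSpan ℝ hvF hv₀F)
            rw [hsymm, hz' _ (hsW v hvF.1)]
            exact hfU hvU
          have := hz' a haW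
          rw [hz0] at this
          simp at this
          exact hfa this.symm
        have h1 := Submodule.finrank_mono hle
        have h2 := Submodule.finrank_add_le_finrank_add_finrank
          (Submodule.span ℝ {v₀ - o}) (vectorSpan ℝ F)
        have h3 : Module.finrank ℝ (Submodule.span ℝ {v₀ - o}) ≤ 1 := by
          have := finrank_span_le_card (R := ℝ) ({v₀ - o} : Set M)
          simpa using this
        change Module.finrank ℝ W ≤ Module.finrank ℝ (vectorSpan ℝ F) + 1
        omega
  · intro w hw w' hw' heq
    have h0 : w - w' = 0 := by
      have e : w - w' = (w - o) - (w' - o) := by abel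
      refine hact w hw _ (by rw [e]; exact W.sub_mem hw.1.1 hw'.1.1) fun v hv h1 => ?_
      have h2 : v ∈ {x ∈ convexHull ℝ s | B (w' - o) (x - o) = 1} := by
        rw [← show _ = {x ∈ convexHull ℝ s | B (w' - o) (x - o) = 1} from heq]
        exact ⟨subset_convexHull ℝ s hv, by rw [hsymm]; exact h1⟩
      rw [e, map_sub, h1, hsymm (v - o), h2.2, sub_self]
    exact sub_eq_zero.1 h0

/-- For a body which is, up to a homothety, its own polar, the two dimensions agree. -/
theorem facialDim_eq_verticialDim [LocallyConvexSpace ℝ M] (hsymm : ∀ x y, B x y = B y x)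
    (hnd : ∀ x ∈ W, (∀ y ∈ W, B x y = 0) → x = 0) (hW : W ≠ ⊥) {K : Set M} {A : ℝ} (hA : 0 < A)
    (hKc : IsCompact K) (hKW : ∀ x ∈ K, x - o ∈ W) (ho : o ∈ K)
    (habs : ∀ z ∈ W, ∃ t : ℝ, 0 < t ∧ o + t • z ∈ K)
    (hK : ∀ x, x - o ∈ W → (x ∈ K ↔ ∀ y ∈ K, A * B (y - o) (x - o) ≤ 1)) :
    facialDim o K A = verticialDim o K A := by
  have hAK : IsCompact (AffineMap.homothety o A '' K) := by
    refine hKc.image ?_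
    have : (AffineMap.homothety o A : M → M) = fun x => A • (x - o) + o := by
      ext x; simp [AffineMap.homothety_apply]
    rw [this]; fun_prop
  have hAW : ∀ x ∈ AffineMap.homothety o A '' K, x - o ∈ W := by
    rintro _ ⟨x, hx, rfl⟩
    simpa [AffineMap.homothety_apply] using W.smul_mem A (hKW x hx)
  have hsp : ∀ P : Set M, K ⊆ P → P ⊆ AffineMap.homothety o A '' K → vectorSpan ℝ P = W :=
    fun P h1 h2 => vectorSpan_eq_of_absorbing (fun x hx => hAW x (h2 hx)) (h1 ho)
      fun z hz => (habs z hz).imp fun t ht => ⟨ht.1, h1 ht.2⟩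
  have le_of : ∀ S T : Set ℕ, (∀ N ∈ T, ∃ N' ∈ S, N' ≤ N) → T.Nonempty → sInf S ≤ sInf T := by
    intro S T h hT
    obtain ⟨N', hN', hle⟩ := h _ (Nat.sInf_mem hT)
    exact (Nat.sInf_le hN').trans hle
  unfold facialDim verticialDim
  set S := {N : ℕ | ∃ P : Set M, IsPolytope P ∧ (facetSet P).encard = N ∧
    K ⊆ P ∧ P ⊆ AffineMap.homothety o A '' K}
  set T := {N : ℕ | ∃ P : Set M, IsPolytope P ∧ (vertexSet P).encard = N ∧
    K ⊆ P ∧ P ⊆ AffineMap.homothety o A '' K}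
  have hTS : ∀ N ∈ T, ∃ N' ∈ S, N' ≤ N := by
    rintro N ⟨P, hP, hN, h1, h2⟩
    obtain ⟨hfin, hPV⟩ := hP.eq_convexHull_vertexSet
    obtain ⟨h3, h4⟩ := polarIn_between hA hKW hK h1 h2
    have hpol : polarIn B o W P = polarIn B o W (vertexSet P) := by
      conv_lhs => rw [hPV]
      exact polarIn_convexHull _
    rw [hpol] at h3 h4
    obtain ⟨N', hle, hN'⟩ := exists_encard_facetSet_polarIn hfin hN (hsp _ h3 h4)
    exact ⟨N', ⟨_, isPolytope_polarIn hfin hAK h4, hN', h3, h4⟩, hle⟩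
  have hST : ∀ N ∈ S, ∃ N' ∈ T, N' ≤ N := by
    rintro N ⟨P, ⟨s, hs, rfl⟩, hN, h1, h2⟩
    obtain ⟨h3, h4⟩ := polarIn_between hA hKW hK h1 h2
    obtain ⟨N', hle, hN'⟩ := exists_encard_vertexSet_polarIn hsymm hnd hW hs (hsp _ h1 h2)
      (fun x hx => hAW x (h2 hx)) hN
    rw [polarIn_convexHull] at h3 h4
    exact ⟨N', ⟨_, isPolytope_polarIn hs hAK h4, hN', h3, h4⟩, hle⟩
  have heq : sInf S = sInf T := by
    rcases T.eq_empty_or_nonempty with hT | hT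
    · have hS : S = ∅ := by
        by_contra hne
        obtain ⟨N, hN⟩ := Set.nonempty_iff_ne_empty.2 hne
        obtain ⟨N', hN', -⟩ := hST N hN
        rw [hT] at hN'; exact hN'
      rw [hS, hT]
    · have hS : S.Nonempty := by
        obtain ⟨N, hN⟩ := hT
        obtain ⟨N', hN', -⟩ := hTS N hN
        exact ⟨N', hN'⟩
      exact le_antisymm (le_of S T hTS hT) (le_of T S hST hS)
  rw [heq]

end Duality

/-! ### The body of states: compactness and self-polarity. -/

section QuantumStates

open Matrix

variable {m : ℕ}

instance : LocallyConvexSpace ℝ (Matrix (Fin m) (Fin m) ℂ) :=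
  inferInstanceAs (LocallyConvexSpace ℝ (Fin m → Fin m → ℂ))

open scoped MatrixOrder Matrix.Norms.L2Operator in
lemma Matrix.PosSemidef.exists_eq_conjTranspose_mul_self {ρ : Matrix (Fin m) (Fin m) ℂ}
    (h : ρ.PosSemidef) : ∃ B : Matrix (Fin m) (Fin m) ℂ, ρ = Bᴴ * B :=
  CStarAlgebra.nonneg_iff_eq_star_mul_self.mp h.nonneg

open scoped MatrixOrder Matrix.Norms.L2Operator in
lemma Matrix.IsHermitian.exists_add_smul_one_posSemidef {Z : Matrix (Fin m) (Fin m) ℂ}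
    (h : Z.IsHermitian) : ∃ c : ℝ, 0 < c ∧ (Z + c • (1 : Matrix (Fin m) (Fin m) ℂ)).PosSemidef := by
  refine ⟨‖Z‖ + 1, by positivity, ?_⟩
  have h1 := IsSelfAdjoint.neg_algebraMap_norm_le_self (a := Z) h
  rw [Matrix.le_iff, sub_neg_eq_add, Algebra.algebraMap_eq_smul_one] at h1
  rw [add_smul, one_smul, ← add_assoc]
  exact h1.add PosSemidef.one

lemma trace_conjTranspose_mul_self_eq_sum (B : Matrix (Fin m) (Fin m) ℂ) :
    (Bᴴ * B).trace = ((∑ r, ∑ k, ‖B r k‖ ^ 2 : ℝ) : ℂ) := by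
  rw [Matrix.trace, Finset.sum_comm]
  push_cast
  refine Finset.sum_congr rfl fun k _ => ?_
  rw [diag_apply, mul_apply]
  refine Finset.sum_congr rfl fun r _ => ?_
  rw [conjTranspose_apply]
  exact RCLike.conj_mul _

lemma trace_vecMulVec_star_self (x : Fin m → ℂ) :
    (vecMulVec x (star x)).trace = ((∑ k, ‖x k‖ ^ 2 : ℝ) : ℂ) := by
  rw [Matrix.trace]
  push_cast
  refine Finset.sum_congr rfl fun k _ => ?_
  rw [diag_apply, vecMulVec_apply]
  exact RCLike.mul_conj _

lemma trace_vecMulVec_mul (x : Fin m → ℂ) (A : Matrix (Fin m) (Fin m) ℂ) :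
    (vecMulVec x (star x) * A).trace = star x ⬝ᵥ (A *ᵥ x) := by
  rw [vecMulVec_mul, trace_vecMulVec, dotProduct_comm, dotProduct_mulVec]

lemma sum_norm_sq_pos {x : Fin m → ℂ} (hx : x ≠ 0) : 0 < ∑ k, ‖x k‖ ^ 2 := by
  obtain ⟨k, hk⟩ := Function.ne_iff.1 hx
  refine Finset.sum_pos' (fun _ _ => by positivity) ⟨k, Finset.mem_univ _, ?_⟩
  have : 0 < ‖x k‖ := norm_pos_iff.2 hk
  positivity

lemma Matrix.PosSemidef.real_smul {ρ : Matrix (Fin m) (Fin m) ℂ} (h : ρ.PosSemidef) {c : ℝ}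
    (hc : 0 ≤ c) : (c • ρ).PosSemidef := h.smul hc

/-- The pure state spanned by a nonzero vector. -/
lemma pureState_mem {x : Fin m → ℂ} (hx : x ≠ 0) :
    (∑ k, ‖x k‖ ^ 2 : ℝ)⁻¹ • vecMulVec x (star x) ∈ quantumStates m := by
  have h := sum_norm_sq_pos hx
  refine ⟨(posSemidef_vecMulVec_self_star x).real_smul (by positivity), ?_⟩
  rw [trace_smul, trace_vecMulVec_star_self, Complex.real_smul, ← Complex.ofReal_mul,
    inv_mul_cancel₀ h.ne', Complex.ofReal_one]

lemma isCompact_quantumStates (m : ℕ) : IsCompact (quantumStates m) := by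
  have himg : quantumStates m = (fun B : Matrix (Fin m) (Fin m) ℂ => Bᴴ * B) ''
      {B | ∑ r, ∑ k, ‖B r k‖ ^ 2 = 1} := by
    ext ρ
    constructor
    · rintro ⟨h1, h2⟩
      obtain ⟨B, rfl⟩ := h1.exists_eq_conjTranspose_mul_self
      refine ⟨B, ?_, rfl⟩
      rw [trace_conjTranspose_mul_self_eq_sum] at h2
      exact_mod_cast h2
    · rintro ⟨B, hB, rfl⟩
      refine ⟨posSemidef_conjTranspose_mul_self B, ?_⟩
      rw [trace_conjTranspose_mul_self_eq_sum, show (∑ r, ∑ k, ‖B r k‖ ^ 2 : ℝ) = 1 from hB,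
        Complex.ofReal_one]
  rw [himg]
  refine IsCompact.image ?_ (by fun_prop)
  have hc : IsCompact (Set.univ.pi fun _ : Fin m => Set.univ.pi fun _ : Fin m =>
      Metric.closedBall (0 : ℂ) 1) :=
    isCompact_univ_pi fun _ => isCompact_univ_pi fun _ => isCompact_closedBall _ _
  refine IsCompact.of_isClosed_subset hc (isClosed_eq ?_ continuous_const) ?_
  · exact continuous_finsetSum _ fun r _ => continuous_finsetSum _ fun k _ =>
      ((continuous_apply_apply r k).norm.pow 2)
  · intro B hB r _ k _
    have hB : ∑ r, ∑ k, ‖B r k‖ ^ 2 = 1 := hB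
    have h1 : ‖B r k‖ ^ 2 ≤ ∑ k, ‖B r k‖ ^ 2 :=
      Finset.single_le_sum (f := fun k => ‖B r k‖ ^ 2) (fun _ _ => by positivity)
        (Finset.mem_univ k)
    have h2 : ∑ k, ‖B r k‖ ^ 2 ≤ ∑ r, ∑ k, ‖B r k‖ ^ 2 :=
      Finset.single_le_sum (f := fun r => ∑ k, ‖B r k‖ ^ 2) (fun _ _ => by positivity)
        (Finset.mem_univ r)
    rw [mem_closedBall_zero_iff]
    nlinarith [norm_nonneg (B r k)]

lemma convex_quantumStates (m : ℕ) : Convex ℝ (quantumStates m) := by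
  rintro a ⟨ha, ha'⟩ b ⟨hb, hb'⟩ s t hs ht hst
  refine ⟨(ha.real_smul hs).add (hb.real_smul ht), ?_⟩
  rw [trace_add, trace_smul, trace_smul, ha', hb', Complex.real_smul, Complex.real_smul, mul_one,
    mul_one, ← Complex.ofReal_add, hst, Complex.ofReal_one]

/-- The trace form `(X, Y) ↦ c * Re tr (X Y)`. -/
noncomputable def reTraceForm (m : ℕ) (c : ℝ) :
    LinearMap.BilinForm ℝ (Matrix (Fin m) (Fin m) ℂ) :=
  LinearMap.mk₂ ℝ (fun X Y => c * (X * Y).trace.re)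
    (fun X X' Y => by simp [add_mul, mul_add]) (fun a X Y => by simp; ring)
    (fun X Y Y' => by simp [mul_add]) (fun a X Y => by simp; ring)

lemma reTraceForm_apply (c : ℝ) (X Y : Matrix (Fin m) (Fin m) ℂ) :
    reTraceForm m c X Y = c * (X * Y).trace.re := rfl

/-- The real space of traceless Hermitian matrices. -/
def tracelessHermitian (m : ℕ) : Submodule ℝ (Matrix (Fin m) (Fin m) ℂ) where
  carrier := {X | X.IsHermitian ∧ X.trace = 0}
  add_mem' := fun ha hb => ⟨ha.1.add hb.1, by rw [trace_add, ha.2, hb.2, add_zero]⟩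
  zero_mem' := ⟨isHermitian_zero, trace_zero _ _⟩
  smul_mem' := fun c X hX => ⟨by
    rw [IsHermitian, conjTranspose_smul, hX.1.eq, star_trivial], by
    rw [trace_smul, hX.2, smul_zero]⟩

lemma Matrix.PosSemidef.trace_mul_re_nonneg {X Y : Matrix (Fin m) (Fin m) ℂ} (hX : X.PosSemidef)
    (hY : Y.PosSemidef) : 0 ≤ (X * Y).trace.re := by
  obtain ⟨C, rfl⟩ := hX.exists_eq_conjTranspose_mul_self
  have h := (hY.mul_mul_conjTranspose_same C).trace_nonneg
  rw [Matrix.mul_assoc, trace_mul_comm]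
  exact (Complex.le_def.1 h).1

lemma trace_maximallyMixed (hm : m ≠ 0) : (maximallyMixed m).trace = 1 := by
  have : (m : ℂ) ≠ 0 := by exact_mod_cast hm
  simp [maximallyMixed, trace_smul, this]

lemma maximallyMixed_eq (m : ℕ) :
    maximallyMixed m = (m : ℝ)⁻¹ • (1 : Matrix (Fin m) (Fin m) ℂ) := by
  ext i j
  simp [maximallyMixed]

lemma maximallyMixed_mem (hm : m ≠ 0) : maximallyMixed m ∈ quantumStates m := by
  refine ⟨?_, trace_maximallyMixed hm⟩
  rw [maximallyMixed_eq]
  exact PosSemidef.one.real_smul (by positivity)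

lemma trace_sub_mul_sub_re (hm : m ≠ 0) {x y : Matrix (Fin m) (Fin m) ℂ} (hx : x.trace = 1)
    (hy : y.trace = 1) :
    ((y - maximallyMixed m) * (x - maximallyMixed m)).trace.re = (y * x).trace.re - (m : ℝ)⁻¹ := by
  have hm' : (m : ℝ) ≠ 0 := by exact_mod_cast hm
  simp only [maximallyMixed_eq, sub_mul, mul_sub, trace_sub, smul_mul_assoc, mul_smul_comm,
    trace_smul, Matrix.one_mul, Matrix.mul_one, hx, hy, Matrix.trace_one, Complex.sub_re,
    Complex.real_smul, Complex.re_ofReal_mul]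
  simp
  field_simp
  ring

/-- The left side of the inequality equals `1 - m Re tr(yx)`, so the condition is `Re tr(yx) ≥ 0`
for all states `y`. This is self-duality of the positive semidefinite cone; pure `y` suffice for the
converse. -/
lemma quantumStates_self_polar (hm : m ≠ 0) {x : Matrix (Fin m) (Fin m) ℂ}
    (hx : x - maximallyMixed m ∈ tracelessHermitian m) :
    x ∈ quantumStates m ↔ ∀ y ∈ quantumStates m, 4 * reTraceForm m (-(m / 4))
      (y - maximallyMixed m) (x - maximallyMixed m) ≤ 1 := by
  have hm' : (m : ℝ) ≠ 0 := by exact_mod_cast hm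
  have hmpos : (0 : ℝ) < m := by positivity
  have htr : x.trace = 1 := by
    have := hx.2
    rwa [trace_sub, trace_maximallyMixed hm, sub_eq_zero] at this
  have hherm : x.IsHermitian := by
    have := hx.1.add (maximallyMixed_mem hm).1.1
    rwa [sub_add_cancel] at this
  have key : ∀ y ∈ quantumStates m, (4 * reTraceForm m (-(m / 4))
      (y - maximallyMixed m) (x - maximallyMixed m) ≤ 1 ↔ 0 ≤ (y * x).trace.re) := by
    intro y hy
    rw [reTraceForm_apply, trace_sub_mul_sub_re hm htr hy.2]
    have e : 4 * (-(m / 4 : ℝ) * ((y * x).trace.re - (m : ℝ)⁻¹)) = 1 - m * (y * x).trace.re := by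
      field_simp; ring
    rw [e, sub_le_self_iff]
    exact mul_nonneg_iff_of_pos_left hmpos
  constructor
  · exact fun h y hy => (key y hy).2 (hy.1.trace_mul_re_nonneg h.1)
  · intro h
    refine ⟨PosSemidef.of_dotProduct_mulVec_nonneg hherm fun v => ?_, htr⟩
    by_cases hv : v = 0
    · simp [hv]
    have h1 := (key _ (pureState_mem hv)).1 (h _ (pureState_mem hv))
    rw [smul_mul_assoc, trace_smul, Complex.real_smul, Complex.re_ofReal_mul,
      trace_vecMulVec_mul] at h1
    have h2 := (mul_nonneg_iff_of_pos_left (inv_pos.2 (sum_norm_sq_pos hv))).1 h1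
    exact Complex.le_def.2 ⟨h2, (hherm.im_star_dotProduct_mulVec_self v).symm⟩

theorem facialDim_quantumStates_eq (hm : 2 ≤ m) :
    facialDim (maximallyMixed m) (quantumStates m) 4 =
      verticialDim (maximallyMixed m) (quantumStates m) 4 := by
  have hm0 : m ≠ 0 := by omega
  have hmpos : (0 : ℝ) < m := by positivity
  have hself : ∀ x ∈ tracelessHermitian m, reTraceForm m (-(m / 4)) x x = 0 → x = 0 := by
    intro x hx h
    rw [reTraceForm_apply] at h
    have h1 : (x * x).trace.re = 0 := (mul_eq_zero.1 h).resolve_left (by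
      have : (m : ℝ) / 4 ≠ 0 := by positivity
      exact neg_ne_zero.2 this)
    nth_rewrite 1 [← hx.1.eq] at h1
    rw [trace_conjTranspose_mul_self_eq_sum, Complex.ofReal_re] at h1
    ext r k
    have h2 := (Finset.sum_eq_zero_iff_of_nonneg (fun _ _ => by positivity)).1 h1 r
      (Finset.mem_univ _)
    have h3 := (Finset.sum_eq_zero_iff_of_nonneg (fun _ _ => by positivity)).1 h2 k
      (Finset.mem_univ _)
    simpa using h3
  refine facialDim_eq_verticialDim (B := reTraceForm m (-(m / 4))) (W := tracelessHermitian m)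
    (fun x y => by rw [reTraceForm_apply, reTraceForm_apply, trace_mul_comm])
    (fun x hx h => hself x hx (h x hx)) ?_ (by norm_num) (isCompact_quantumStates m)
    (fun x hx => ⟨hx.1.1.sub (maximallyMixed_mem hm0).1.1, by
      rw [trace_sub, hx.2, trace_maximallyMixed hm0, sub_self]⟩)
    (maximallyMixed_mem hm0) ?_ (fun x hx => quantumStates_self_polar hm0 hx)
  · rw [Submodule.ne_bot_iff]
    let i : Fin m := ⟨0, by omega⟩
    let j : Fin m := ⟨1, by omega⟩
    have hij : i ≠ j := by simp [i, j]
    refine ⟨Matrix.single i j 1 + Matrix.single j i 1, ⟨?_, ?_⟩, fun h => ?_⟩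
    · rw [IsHermitian, conjTranspose_add, conjTranspose_single, conjTranspose_single, star_one,
        add_comm]
    · rw [trace_add, trace_single_eq_of_ne _ _ _ hij, trace_single_eq_of_ne _ _ _ hij.symm,
        add_zero]
    · have := congrFun (congrFun h i) j
      simp [hij] at this
  · intro z hz
    -- The state `(z + c Id) / (mc)` is `ρ_*` moved in direction `z`.
    obtain ⟨c, hc, hps⟩ := hz.1.exists_add_smul_one_posSemidef
    refine ⟨(m * c)⁻¹, by positivity, ?_, ?_⟩
    · have e : maximallyMixed m + ((m : ℝ) * c)⁻¹ • z
          = ((m : ℝ) * c)⁻¹ • (z + c • (1 : Matrix (Fin m) (Fin m) ℂ)) := by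
        rw [maximallyMixed_eq, smul_add, smul_smul, add_comm]
        congr 2
        field_simp
      rw [e]
      exact hps.real_smul (by positivity)
    · rw [trace_add, trace_smul, hz.2, smul_zero, add_zero, trace_maximallyMixed hm0]

end QuantumStates

/-! ### Counting integer points. -/

section IntegerPoints

lemma sum_Icc_half_pow_natAbs_le (n : ℕ) :
    ∑ a ∈ Finset.Icc (-(n : ℤ)) n, (1 / 2 : ℝ) ^ a.natAbs = 3 - 2 * (1 / 2) ^ n := by
  induction n with
  | zero => norm_num
  | succ n ih =>
    have h : Finset.Icc (-((n + 1 : ℕ) : ℤ)) ((n + 1 : ℕ) : ℤ)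
        = insert ((n + 1 : ℕ) : ℤ) (insert (-((n + 1 : ℕ) : ℤ)) (Finset.Icc (-(n : ℤ)) n)) := by
      ext a
      simp only [Finset.mem_Icc, Finset.mem_insert]
      omega
    rw [h, Finset.sum_insert, Finset.sum_insert, ih, Int.natAbs_neg, Int.natAbs_natCast, pow_succ]
    · ring
    · simp
    · simp only [Finset.mem_Icc, Finset.mem_insert]
      omega

/-- The number of integer points in an `ℓ¹` ball. -/
lemma exists_finset_integer_points (ι : Type*) [Fintype ι] [DecidableEq ι] (K : ℕ) :
    ∃ G : Finset (ι → ℤ), G.card ≤ 2 ^ K * 3 ^ Fintype.card ι ∧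
      ∀ g : ι → ℤ, ∑ i, (g i).natAbs ≤ K → g ∈ G := by
  set box := Fintype.piFinset fun _ : ι => Finset.Icc (-(K : ℤ)) K
  refine ⟨box.filter fun g => ∑ i, (g i).natAbs ≤ K, ?_, fun g hg => ?_⟩
  · set G := box.filter fun g => ∑ i, (g i).natAbs ≤ K
    -- Give `g` the weight `2^{-‖g‖₁}`: it is at least `2^{-K}` on the ball, and the total over the
    -- box factors into sums of at most 3 each.
    have h1 : (G.card : ℝ) * (1 / 2) ^ K ≤ 3 ^ Fintype.card ι := calc
      (G.card : ℝ) * (1 / 2) ^ K = ∑ g ∈ G, (1 / 2 : ℝ) ^ K := by simp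
      _ ≤ ∑ g ∈ G, ∏ i, (1 / 2 : ℝ) ^ (g i).natAbs := by
        refine Finset.sum_le_sum fun g hg => ?_
        rw [Finset.prod_pow_eq_pow_sum]
        exact pow_le_pow_of_le_one (by norm_num) (by norm_num) (Finset.mem_filter.1 hg).2
      _ ≤ ∑ g ∈ box, ∏ i, (1 / 2 : ℝ) ^ (g i).natAbs :=
        Finset.sum_le_sum_of_subset_of_nonneg (Finset.filter_subset _ _) fun _ _ _ => by positivity
      _ = ∏ _i : ι, ∑ a ∈ Finset.Icc (-(K : ℤ)) K, (1 / 2 : ℝ) ^ a.natAbs :=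
        Finset.sum_prod_piFinset (R := ℝ) _ fun (_ : ι) (a : ℤ) => (1 / 2 : ℝ) ^ a.natAbs
      _ ≤ ∏ _i : ι, (3 : ℝ) := by
        refine Finset.prod_le_prod (fun _ _ => by positivity) fun _ _ => ?_
        rw [sum_Icc_half_pow_natAbs_le]
        have : (0 : ℝ) < (1 / 2) ^ K := by positivity
        linarith
      _ = 3 ^ Fintype.card ι := by simp
    have h2 : (G.card : ℝ) ≤ 2 ^ K * 3 ^ Fintype.card ι := calc
      (G.card : ℝ) = 2 ^ K * (G.card * (1 / 2) ^ K) := by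
        rw [mul_left_comm, ← mul_pow]; norm_num
      _ ≤ _ := by gcongr
    exact_mod_cast h2
  · refine Finset.mem_filter.2 ⟨Fintype.mem_piFinset.2 fun i => ?_, hg⟩
    have := Finset.single_le_sum (f := fun i => (g i).natAbs) (fun _ _ => by positivity)
      (Finset.mem_univ i)
    have h2 := this.trans hg
    rw [Finset.mem_Icc]
    omega

end IntegerPoints

/-! ### Upper bound: rounding pure states to integer vectors. -/

section Rounding

open Matrix

variable {m : ℕ}

/-- The rank-one matrix `|x⟩⟨x|`. -/
def dyad (x : Fin m → ℂ) : Matrix (Fin m) (Fin m) ℂ := vecMulVec x (star x)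

lemma dyad_smul (c : ℝ) (x : Fin m → ℂ) : dyad (c • x) = (c ^ 2) • dyad x := by
  ext i j
  simp [dyad, vecMulVec_apply]
  ring

/-- Second moment of the unbiased rounding of `y + θu` to `y + u` with probability `θ` and to `y`
otherwise; `θ - θ²` is the variance. -/
lemma dyad_rounding (y u : Fin m → ℂ) (θ : ℝ) :
    dyad (y + θ • u) + (θ - θ ^ 2) • dyad u = (1 - θ) • dyad y + θ • dyad (y + u) := by
  ext i j
  simp [dyad, vecMulVec_apply]
  ring

/-- The complex vector with given real and imaginary parts. -/
noncomputable def ofReIm (a : Fin m × Bool → ℝ) : Fin m → ℂ :=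
  fun k => a (k, false) + a (k, true) * Complex.I

lemma ofReIm_add_smul (a b : Fin m × Bool → ℝ) (t : ℝ) :
    ofReIm (a + t • b) = ofReIm a + t • ofReIm b := by
  ext k
  simp [ofReIm]
  ring

lemma norm_sq_ofReIm (a : Fin m × Bool → ℝ) (k : Fin m) :
    ‖ofReIm a k‖ ^ 2 = a (k, false) ^ 2 + a (k, true) ^ 2 := by
  rw [← Complex.normSq_eq_norm_sq, ofReIm, Complex.normSq_add_mul_I]

lemma sum_norm_sq_ofReIm (a : Fin m × Bool → ℝ) : ∑ k, ‖ofReIm a k‖ ^ 2 = ∑ i, a i ^ 2 := by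
  rw [Fintype.sum_prod_type]
  refine Finset.sum_congr rfl fun k _ => ?_
  rw [norm_sq_ofReIm, Fintype.sum_bool, add_comm]

lemma dyad_ofReIm_single (k : Fin m) (b : Bool) :
    dyad (ofReIm (Pi.single (k, b) 1)) = Matrix.single k k 1 := by
  have h : ofReIm (Pi.single (k, b) 1) = Pi.single k (if b then Complex.I else 1) := by
    ext l
    by_cases hl : l = k
    · subst hl; cases b <;> simp [ofReIm]
    · simp [ofReIm, hl]
  ext i j
  rw [h, dyad, vecMulVec_apply, Matrix.single_apply, Pi.star_apply, Pi.single_apply,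
    Pi.single_apply]
  by_cases hi : i = k <;> by_cases hj : j = k <;> cases b <;>
    simp [hi, hj, Ne.symm]

lemma sum_single_diag_eq_one : ∑ k : Fin m, Matrix.single k k (1 : ℂ) = 1 := by
  ext i j
  simp [Matrix.sum_apply, Matrix.single_apply, Matrix.one_apply, ite_and]

/-- Rounding the coordinates of a vector to integers, one after the other: a convex cone that
contains the dyads of the small nonzero integer vectors contains `|x⟩⟨x|` up to a multiple of the
identity. -/
lemma dyad_add_mem_of_rounding (hm : m ≠ 0) (C : ConvexCone ℝ (Matrix (Fin m) (Fin m) ℂ)) (K : ℕ)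
    (hK : 1 ≤ K)
    (hC : ∀ g : Fin m × Bool → ℤ, ∑ i, (g i).natAbs ≤ K → ofReIm (fun i => (g i : ℝ)) ≠ 0 →
      dyad (ofReIm fun i => (g i : ℝ)) ∈ C)
    {a : Fin m × Bool → ℝ} (ha : ∑ i, |a i| + 2 * m ≤ K) :
    dyad (ofReIm a) + (3 : ℝ) • (1 : Matrix (Fin m) (Fin m) ℂ) ∈ C := by
  have hu : ∀ i : Fin m × Bool, dyad (ofReIm (Pi.single i 1)) ∈ C := by
    rintro i
    have e : (fun j => ((Pi.single i 1 : Fin m × Bool → ℤ) j : ℝ)) = Pi.single i 1 := by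
      ext j
      by_cases h : j = i
      · subst h; simp
      · simp [h]
    have h := hC (Pi.single i 1) ?_ ?_
    · rwa [e] at h
    · refine le_trans (le_of_eq ?_) hK
      rw [Finset.sum_eq_single i]
      · simp
      · intro j _ hj; simp [hj]
      · simp
    · rw [e]
      intro h0
      have h1 := dyad_ofReIm_single i.1 i.2
      rw [Prod.mk.eta, h0] at h1
      have := congrFun (congrFun h1 i.1) i.1
      simp [dyad] at this
  have hone : (1 : Matrix (Fin m) (Fin m) ℂ) ∈ C := by
    have : Nonempty (Fin m) := ⟨⟨0, Nat.pos_of_ne_zero hm⟩⟩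
    rw [← sum_single_diag_eq_one]
    refine Finset.sum_induction_nonempty _ (· ∈ C) (fun _ _ h h' => C.add_mem h h')
      Finset.univ_nonempty fun k _ => ?_
    rw [← dyad_ofReIm_single k false]
    exact hu _
  -- `T` contains the coordinates still to be rounded; each costs at most 1 in `ℓ¹` norm and one
  -- dyad. The extra `1` covers rounding to the zero vector, whose dyad need not lie in `C`.
  have key : ∀ T : Finset (Fin m × Bool), ∀ a : Fin m × Bool → ℝ,
      (∀ i ∉ T, ∃ n : ℤ, a i = n) → ∑ i, |a i| + T.card ≤ K →
      dyad (ofReIm a) + (1 + ∑ i ∈ T, dyad (ofReIm (Pi.single i 1))) ∈ C := by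
    intro T
    induction T using Finset.induction_on with
    | empty =>
      intro a hint hle
      choose g hg using fun i => hint i (Finset.notMem_empty i)
      obtain rfl : a = fun i => (g i : ℝ) := funext hg
      rw [Finset.sum_empty, add_zero]
      by_cases h0 : ofReIm (fun i => (g i : ℝ)) = 0
      · have : dyad (0 : Fin m → ℂ) = 0 := by simp [dyad]
        rw [h0, this, zero_add]; exact hone
      · refine C.add_mem (hC g ?_ h0) hone
        have : ((∑ i, (g i).natAbs : ℕ) : ℝ) ≤ K := by
          push_cast
          simpa [Nat.cast_natAbs] using hle
        exact_mod_cast this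
    | insert j T hj ih =>
      intro a hint hle
      set n := ⌊a j⌋
      set θ := Int.fract (a j)
      set u := ofReIm (m := m) (Pi.single j 1)
      have hθ : a j = n + θ := (Int.floor_add_fract _).symm
      have hθ0 : 0 ≤ θ := Int.fract_nonneg _
      have hθ1 : θ < 1 := Int.fract_lt_one _
      have hupd : ∀ t : ℝ, Function.update a j t
          = Function.update a j (n : ℝ) + (t - n) • Pi.single j (1 : ℝ) := by
        intro t
        ext i
        by_cases h : i = j
        · subst h; simp
        · simp [h]
      have hmem : ∀ k : ℤ, |(k : ℝ)| ≤ |a j| + 1 → dyad (ofReIm (Function.update a j (k : ℝ))) +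
          (1 + ∑ i ∈ T, dyad (ofReIm (Pi.single i 1))) ∈ C := by
        intro k hk
        refine ih _ (fun i hi => ?_) ?_
        · by_cases h : i = j
          · subst h; exact ⟨k, by simp⟩
          · rw [Function.update_of_ne h]
            exact hint i (by simp [h, hi])
        · rw [Finset.card_insert_of_notMem hj] at hle
          push_cast at hle
          rw [← Finset.add_sum_erase _ _ (Finset.mem_univ j)] at hle ⊢
          rw [Function.update_self, Finset.sum_congr rfl (g := fun i => |a i|) fun i hi => by
            rw [Function.update_of_ne (Finset.ne_of_mem_erase hi)]]
          linarith
      have h0 := hmem n (by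
        rw [hθ]
        rw [abs_le]
        constructor <;> rcases abs_cases ((n : ℝ) + θ) with h | h <;> linarith)
      have h1 := hmem (n + 1) (by
        rw [hθ]; push_cast
        rw [abs_le]
        constructor <;> rcases abs_cases ((n : ℝ) + θ) with h | h <;> linarith)
      have e1 : ofReIm (Function.update a j ((n + 1 : ℤ) : ℝ))
          = ofReIm (Function.update a j (n : ℝ)) + u := by
        rw [hupd, ofReIm_add_smul]; push_cast; simp [u]
      have ea : ofReIm a = ofReIm (Function.update a j (n : ℝ)) + θ • u := by
        conv_lhs => rw [← Function.update_eq_self j a]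
        rw [hupd, ofReIm_add_smul, hθ, add_sub_cancel_left]
      rw [e1] at h1
      set y := ofReIm (Function.update a j (n : ℝ))
      set R := (1 : Matrix (Fin m) (Fin m) ℂ) + ∑ i ∈ T, dyad (ofReIm (Pi.single i 1))
      have hcomb : (1 - θ) • (dyad y + R) + θ • (dyad (y + u) + R) ∈ C := by
        rcases hθ0.eq_or_lt with h | h
        · rw [← h]; simpa using h0
        · exact C.add_mem (C.smul_mem (by linarith) h0) (C.smul_mem h h1)
      -- This pads the variance `θ - θ²` to exactly 1, so that the total error does not depend on
      -- `a`.
      have hfin := C.add_mem hcomb (C.smul_mem (show 0 < 1 - θ + θ ^ 2 by nlinarith) (hu j))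
      have hr := dyad_rounding y u θ
      rw [Finset.sum_insert hj, ea]
      convert hfin using 1
      have hr' : dyad (y + θ • u) = (1 - θ) • dyad y + θ • dyad (y + u) - (θ - θ ^ 2) • dyad u :=
        eq_sub_of_add_eq hr
      rw [hr']
      simp only [R]
      module
  have h := key Finset.univ a (fun i hi => absurd (Finset.mem_univ i) hi) (by
    refine le_trans (le_of_eq ?_) ha
    simp; ring)
  have hs : ∑ i : Fin m × Bool, dyad (ofReIm (Pi.single i 1))
      = (2 : ℝ) • (1 : Matrix (Fin m) (Fin m) ℂ) := by
    rw [Fintype.sum_prod_type, ← sum_single_diag_eq_one, Finset.smul_sum]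
    refine Finset.sum_congr rfl fun k _ => ?_
    rw [Fintype.sum_bool, dyad_ofReIm_single, dyad_ofReIm_single, two_smul]
  rw [hs] at h
  convert h using 2
  module

lemma conjTranspose_mul_self_eq_sum_dyad (B : Matrix (Fin m) (Fin m) ℂ) :
    Bᴴ * B = ∑ r, dyad (star (B r)) := by
  ext i j
  simp [Matrix.mul_apply, Matrix.sum_apply, dyad, vecMulVec_apply]

lemma trace_one_of_mem_convexHull {S : Set (Matrix (Fin m) (Fin m) ℂ)}
    (hS : S ⊆ quantumStates m) {y : Matrix (Fin m) (Fin m) ℂ} (hy : y ∈ convexHull ℝ S) :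
    y.trace = 1 := (convexHull_min hS (convex_quantumStates m) hy).2

/-- The states can be approximated by a polytope with exponentially many vertices. -/
theorem exists_polytope_between (hm : m ≠ 0) :
    ∃ N : ℕ, N ≤ 2 ^ (4 * m) * 3 ^ (2 * m) ∧ ∃ P : Set (Matrix (Fin m) (Fin m) ℂ),
      IsPolytope P ∧ (vertexSet P).encard = N ∧ quantumStates m ⊆ P ∧
        P ⊆ AffineMap.homothety (maximallyMixed m) (4 : ℝ) '' quantumStates m := by
  classical
  have hmpos : (0 : ℝ) < m := by positivity
  obtain ⟨G, hGcard, hG⟩ := exists_finset_integer_points (Fin m × Bool) (4 * m)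
  set σ : (Fin m × Bool → ℤ) → Matrix (Fin m) (Fin m) ℂ := fun g =>
    (∑ k, ‖ofReIm (fun i => (g i : ℝ)) k‖ ^ 2)⁻¹ • dyad (ofReIm fun i => (g i : ℝ)) with hσ
  set S : Set (Matrix (Fin m) (Fin m) ℂ) :=
    σ '' (G.filter fun g => ofReIm (fun i => (g i : ℝ)) ≠ 0) with hS
  have hSD : S ⊆ quantumStates m := by
    rintro _ ⟨g, hg, rfl⟩
    exact pureState_mem (Finset.mem_filter.1 (Finset.mem_coe.1 hg)).2
  have hSfin : S.Finite := (Finset.finite_toSet _).image _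
  have hScard : S.encard ≤ (2 ^ (4 * m) * 3 ^ (2 * m) : ℕ) := by
    refine (Set.encard_image_le _ _).trans ?_
    rw [Set.encard_coe_eq_coe_finsetCard]
    refine Nat.cast_le.2 ((Finset.card_filter_le _ _).trans (hGcard.trans (le_of_eq ?_)))
    simp [mul_comm]
  have hSP : quantumStates m ⊆
      AffineMap.homothety (maximallyMixed m) (4 : ℝ) '' convexHull ℝ S := by
    set C := ConvexCone.hull ℝ (convexHull ℝ S)
    have hC : ∀ g : Fin m × Bool → ℤ, ∑ i, (g i).natAbs ≤ 4 * m →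
        ofReIm (fun i => (g i : ℝ)) ≠ 0 → dyad (ofReIm fun i => (g i : ℝ)) ∈ C := by
      intro g hg h0
      have h1 : σ g ∈ C := ConvexCone.subset_hull (subset_convexHull ℝ S
        ⟨g, Finset.mem_coe.2 (Finset.mem_filter.2 ⟨hG g hg, h0⟩), rfl⟩)
      have h2 := C.smul_mem (sum_norm_sq_pos h0) h1
      rwa [hσ, smul_smul, mul_inv_cancel₀ (sum_norm_sq_pos h0).ne', one_smul] at h2
    have hdy : ∀ x : Fin m → ℂ, ∑ k, ‖x k‖ ^ 2 = m →
        dyad x + (3 : ℝ) • (1 : Matrix (Fin m) (Fin m) ℂ) ∈ C := by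
      intro x hx
      obtain ⟨a, rfl⟩ : ∃ a, x = ofReIm a :=
        ⟨fun i => if i.2 then (x i.1).im else (x i.1).re, by ext k; simp [ofReIm]⟩
      refine dyad_add_mem_of_rounding hm C (4 * m) (by omega) hC ?_
      rw [sum_norm_sq_ofReIm] at hx
      -- The right side is `(m + 2m)/2`; adding `2m` for the rounding gives `7m/2 ≤ 4m`.
      have h1 : ∑ i, |a i| ≤ ∑ i, (a i ^ 2 + 1) / 2 := by
        refine Finset.sum_le_sum fun i _ => ?_
        rw [← sq_abs (a i)]
        nlinarith [sq_nonneg (|a i| - 1)]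
      rw [← Finset.sum_div, Finset.sum_add_distrib, hx] at h1
      simp at h1
      push_cast
      linarith
    -- The cone is closed under positive scalars only, so zero rows of the factor `B` of `ρ` are
    -- carried separately.
    have hb : ∀ b : Fin m → ℂ, let X := dyad b +
        (3 * ((∑ k, ‖b k‖ ^ 2) / m)) • (1 : Matrix (Fin m) (Fin m) ℂ); X = 0 ∨ X ∈ C := by
      intro b
      by_cases h0 : b = 0
      · left; simp [h0, dyad]
      right
      have hs := sum_norm_sq_pos h0
      set s := ∑ k, ‖b k‖ ^ 2
      have h1 := hdy (√(m / s) • b) (by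
        simp only [Pi.smul_apply, norm_smul, mul_pow, ← Finset.mul_sum]
        rw [Real.norm_eq_abs, sq_abs, Real.sq_sqrt (by positivity), div_mul_cancel₀ _ hs.ne'])
      have h2 := C.smul_mem (show 0 < s / m by positivity) h1
      rw [dyad_smul, Real.sq_sqrt (by positivity), smul_add, smul_smul, smul_smul,
        show s / m * (m / s) = 1 by field_simp, one_smul] at h2
      rwa [mul_comm]
    intro ρ hρ
    have hρ4 : ρ + (3 : ℝ) • maximallyMixed m ∈ C := by
      obtain ⟨B, hB⟩ := hρ.1.exists_eq_conjTranspose_mul_self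
      have htr := hρ.2
      rw [hB, trace_conjTranspose_mul_self_eq_sum, Complex.ofReal_eq_one] at htr
      have hsum := Finset.sum_induction (fun r => dyad (star (B r)) +
        (3 * ((∑ k, ‖star (B r) k‖ ^ 2) / m)) • (1 : Matrix (Fin m) (Fin m) ℂ))
        (fun X => X = 0 ∨ X ∈ C) (by
          rintro a b (rfl | ha) (rfl | hb)
          · left; simp
          · right; simpa using hb
          · right; simpa using ha
          · right; exact C.add_mem ha hb) (Or.inl rfl) (s := Finset.univ) (fun r _ => hb _)
      have e : ∑ r, (dyad (star (B r)) +
          (3 * ((∑ k, ‖star (B r) k‖ ^ 2) / m)) • (1 : Matrix (Fin m) (Fin m) ℂ))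
          = ρ + (3 : ℝ) • maximallyMixed m := by
        rw [Finset.sum_add_distrib, ← conjTranspose_mul_self_eq_sum_dyad, ← hB, ← Finset.sum_smul,
          ← Finset.mul_sum, ← Finset.sum_div]
        simp only [Pi.star_apply, norm_star]
        rw [htr, maximallyMixed_eq, smul_smul, one_div]
      rw [e] at hsum
      refine hsum.resolve_left fun h => ?_
      have := congrArg Matrix.trace h
      rw [trace_add, trace_smul, hρ.2, trace_maximallyMixed hm, Complex.real_smul] at this
      norm_num at this
    obtain ⟨r, hr, y, hy, hry⟩ := (ConvexCone.mem_hull_of_convex (convex_convexHull ℝ S)).1 hρ4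
    have hry : r • y = ρ + (3 : ℝ) • maximallyMixed m := hry
    -- Compare traces: `ρ + 3ρ_*` has trace 4 and `y` has trace 1.
    have hr4 : r = 4 := by
      have := congrArg Matrix.trace hry
      rw [trace_add, trace_smul, trace_smul, hρ.2, trace_maximallyMixed hm,
        trace_one_of_mem_convexHull hSD hy, Complex.real_smul, Complex.real_smul, mul_one,
        mul_one] at this
      have h2 : (r : ℂ) = ((4 : ℝ) : ℂ) := by rw [this]; norm_num
      exact_mod_cast h2
    rw [mem_homothety_image_iff (by norm_num : (0 : ℝ) < 4)]
    have : maximallyMixed m + (4 : ℝ)⁻¹ • (ρ - maximallyMixed m) = y := by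
      have h3 : ρ = (4 : ℝ) • y - (3 : ℝ) • maximallyMixed m := by
        rw [← hr4, hry, add_sub_cancel_right]
      rw [h3]; module
    rw [this]; exact hy
  have hconv : AffineMap.homothety (maximallyMixed m) (4 : ℝ) '' convexHull ℝ S
      = convexHull ℝ (AffineMap.homothety (maximallyMixed m) (4 : ℝ) '' S) :=
    AffineMap.image_convexHull _ _
  have hcard : (vertexSet (AffineMap.homothety (maximallyMixed m) (4 : ℝ) '' convexHull ℝ S)).encard
      ≤ (2 ^ (4 * m) * 3 ^ (2 * m) : ℕ) := by
    rw [hconv]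
    exact (Set.encard_le_encard extremePoints_convexHull_subset).trans
      ((Set.encard_image_le _ _).trans hScard)
  obtain ⟨N, hN⟩ := ENat.ne_top_iff_exists.1 (ne_top_of_le_ne_top (ENat.natCast_ne_top _) hcard)
  refine ⟨N, ?_, _, ⟨_, hSfin.image _, hconv⟩, hN.symm, hSP,
    Set.image_mono (convexHull_min hSD (convex_quantumStates m))⟩
  rw [← hN] at hcard
  exact_mod_cast hcard

end Rounding

/-! ### Exponential moments of Rademacher sums. -/

section Signs

/-- The value `±1` of a bit. -/
def signOf (b : Bool) : ℝ := if b then 1 else -1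

/-- Summing over one sign leaves `cosh(2t⟨a,S⟩)`, bounded by `cosh s ≤ exp(s²/2)` and
Cauchy–Schwarz. The price is a slightly larger `t`. -/
lemma exp_norm_add_sq_add_exp_norm_sub_sq_le {E : Type*} [NormedAddCommGroup E]
    [InnerProductSpace ℝ E] (S a : E) {t : ℝ} (ht : t ≤ 1 / 2) :
    Real.exp (t * ‖a + S‖ ^ 2) + Real.exp (t * ‖-a + S‖ ^ 2) ≤
      2 * Real.exp (‖a‖ ^ 2 / 2) * Real.exp (t * (1 + 2 * t * ‖a‖ ^ 2) * ‖S‖ ^ 2) := by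
  set x := inner ℝ a S
  have h1 : ‖a + S‖ ^ 2 = ‖a‖ ^ 2 + 2 * x + ‖S‖ ^ 2 := norm_add_sq_real a S
  have h2 : ‖-a + S‖ ^ 2 = ‖a‖ ^ 2 - 2 * x + ‖S‖ ^ 2 := by
    rw [norm_add_sq_real, norm_neg, inner_neg_left]; ring
  have hx : x ^ 2 ≤ ‖a‖ ^ 2 * ‖S‖ ^ 2 := by
    rw [← mul_pow, ← sq_abs x]
    exact pow_le_pow_left₀ (abs_nonneg _) (abs_real_inner_le_norm a S) 2
  calc Real.exp (t * ‖a + S‖ ^ 2) + Real.exp (t * ‖-a + S‖ ^ 2)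
      = 2 * Real.exp (t * ‖a‖ ^ 2 + t * ‖S‖ ^ 2) * Real.cosh (2 * t * x) := by
        have e1 : t * ‖a + S‖ ^ 2 = t * ‖a‖ ^ 2 + t * ‖S‖ ^ 2 + 2 * t * x := by rw [h1]; ring
        have e2 : t * ‖-a + S‖ ^ 2 = t * ‖a‖ ^ 2 + t * ‖S‖ ^ 2 + -(2 * t * x) := by
          rw [h2]; ring
        rw [e1, e2, Real.exp_add, Real.exp_add _ (-(2 * t * x)), Real.cosh_eq]
        ring
    _ ≤ 2 * Real.exp (t * ‖a‖ ^ 2 + t * ‖S‖ ^ 2) * Real.exp ((2 * t * x) ^ 2 / 2) := by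
        gcongr; exact Real.cosh_le_exp_half_sq _
    _ ≤ _ := by
        rw [mul_assoc, ← Real.exp_add, mul_assoc 2 (Real.exp (‖a‖ ^ 2 / 2)), ← Real.exp_add]
        gcongr 2 * Real.exp ?_
        have h3 : t * ‖a‖ ^ 2 ≤ 1 / 2 * ‖a‖ ^ 2 := by gcongr
        have h4 : t ^ 2 * x ^ 2 ≤ t ^ 2 * (‖a‖ ^ 2 * ‖S‖ ^ 2) := by gcongr
        linarith

/-- Exponential square moments of Rademacher sums in a Hilbert space. -/
lemma sum_exp_norm_rademacher_sq_le {E : Type*} [NormedAddCommGroup E] [InnerProductSpace ℝ E]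
    (n : ℕ) (a : Fin n → E) {t : ℝ} (ht : 0 ≤ t) (h : t * (2 + 2 * ∑ k, ‖a k‖ ^ 2) ≤ 1) :
    ∑ ε : Fin n → Bool, Real.exp (t * ‖∑ k, signOf (ε k) • a k‖ ^ 2) ≤
      2 ^ n * Real.exp ((∑ k, ‖a k‖ ^ 2) / 2) := by
  induction n generalizing t with
  | zero => simp
  | succ n ih =>
    rw [Fin.sum_univ_succ] at h
    set A := ∑ k : Fin n, ‖a k.succ‖ ^ 2 with hA
    have hA0 : 0 ≤ A := Finset.sum_nonneg fun _ _ => by positivity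
    have hα : 0 ≤ ‖a 0‖ ^ 2 := by positivity
    have htα : 0 ≤ t * ‖a 0‖ ^ 2 := by positivity
    have htA : 0 ≤ t * A := by positivity
    have ht2 : t ≤ 1 / 2 := by linarith
    -- The hypothesis on `t` survives the increase because `(1 - s)(1 + s) ≤ 1` with `s = 2t‖a 0‖²`.
    have ih' := ih (fun k => a k.succ) (t := t * (1 + 2 * t * ‖a 0‖ ^ 2)) (by positivity) (by
      rw [← hA]
      have h1 : t * (2 + 2 * A) ≤ 1 - 2 * t * ‖a 0‖ ^ 2 := by linarith
      have h2 : t * (1 + 2 * t * ‖a 0‖ ^ 2) * (2 + 2 * A)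
          = t * (2 + 2 * A) * (1 + 2 * t * ‖a 0‖ ^ 2) := by ring
      rw [h2]
      calc _ ≤ (1 - 2 * t * ‖a 0‖ ^ 2) * (1 + 2 * t * ‖a 0‖ ^ 2) := by gcongr
        _ ≤ 1 := by nlinarith [sq_nonneg (2 * t * ‖a 0‖ ^ 2)])
    rw [← hA] at ih'
    calc ∑ ε : Fin (n + 1) → Bool, Real.exp (t * ‖∑ k, signOf (ε k) • a k‖ ^ 2)
        = ∑ ε : Fin n → Bool, (Real.exp (t * ‖a 0 + ∑ k, signOf (ε k) • a k.succ‖ ^ 2) +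
            Real.exp (t * ‖-a 0 + ∑ k, signOf (ε k) • a k.succ‖ ^ 2)) := by
          rw [← (Fin.consEquiv fun _ => Bool).sum_comp, Fintype.sum_prod_type, Fintype.sum_bool,
            ← Finset.sum_add_distrib]
          refine Finset.sum_congr rfl fun ε _ => ?_
          simp [Fin.consEquiv, Fin.sum_univ_succ, signOf]
      _ ≤ ∑ ε : Fin n → Bool, 2 * Real.exp (‖a 0‖ ^ 2 / 2) *
            Real.exp (t * (1 + 2 * t * ‖a 0‖ ^ 2) * ‖∑ k, signOf (ε k) • a k.succ‖ ^ 2) :=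
          Finset.sum_le_sum fun ε _ => exp_norm_add_sq_add_exp_norm_sub_sq_le _ _ ht2
      _ ≤ 2 * Real.exp (‖a 0‖ ^ 2 / 2) * (2 ^ n * Real.exp (A / 2)) := by
          rw [← Finset.mul_sum]; gcongr
      _ = _ := by
          rw [Fin.sum_univ_succ, ← hA, add_div, Real.exp_add]; ring

end Signs

/-! ### Lower bound: testing vertices against sign vectors. -/

section LowerBound

open Matrix

variable {m : ℕ}

/-- The complex vector of signs. -/
noncomputable def signVec (ε : Fin m → Bool) : Fin m → ℂ := fun k => (signOf (ε k) : ℂ)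

lemma sum_norm_sq_signVec (ε : Fin m → Bool) : ∑ k, ‖signVec ε k‖ ^ 2 = m := by
  have : ∀ k, ‖signVec ε k‖ ^ 2 = 1 := by
    intro k
    unfold signVec signOf
    split_ifs <;> simp
  simp [this]

lemma reTraceForm_dyad_conjTranspose_mul_self (x : Fin m → ℂ) (B : Matrix (Fin m) (Fin m) ℂ) :
    reTraceForm m 1 (dyad x) (Bᴴ * B) = ∑ r, ‖(B *ᵥ x) r‖ ^ 2 := by
  rw [reTraceForm_apply, one_mul, dyad, trace_vecMulVec_mul, ← mulVec_mulVec, dotProduct_mulVec,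
    vecMul_conjTranspose, star_star, dotProduct, Complex.re_sum]
  refine Finset.sum_congr rfl fun r _ => ?_
  rw [Pi.star_apply]
  have : star ((B *ᵥ x) r) * (B *ᵥ x) r = ((‖(B *ᵥ x) r‖ ^ 2 : ℝ) : ℂ) := by
    push_cast; exact RCLike.conj_mul _
  rw [this, Complex.ofReal_re]

/-- With `ρ = BᴴB`, the form at `ε` is `‖∑ ε_k a_k‖²` for the columns `a_k` of `B`, and `∑ ‖a_k‖² =
tr ρ = 1`. The value `t = 1/4` is the largest the moment bound allows. -/
lemma sum_exp_reTraceForm_signVec_le {ρ : Matrix (Fin m) (Fin m) ℂ} (hρ : ρ ∈ quantumStates m) :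
    ∑ ε : Fin m → Bool, Real.exp (1 / 4 * reTraceForm m 1 (dyad (signVec ε)) ρ) ≤
      2 ^ m * Real.exp (1 / 2) := by
  obtain ⟨B, rfl⟩ := hρ.1.exists_eq_conjTranspose_mul_self
  have htr := hρ.2
  rw [trace_conjTranspose_mul_self_eq_sum, Complex.ofReal_eq_one] at htr
  let a : Fin m → EuclideanSpace ℂ (Fin m) := fun k => WithLp.toLp 2 fun r => B r k
  have ha : ∑ k, ‖a k‖ ^ 2 = 1 := by
    rw [← htr, Finset.sum_comm]
    refine Finset.sum_congr rfl fun k _ => ?_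
    rw [EuclideanSpace.norm_sq_eq]
  have h := sum_exp_norm_rademacher_sq_le m a (t := 1 / 4) (by norm_num) (by rw [ha]; norm_num)
  rw [ha] at h
  refine le_trans (le_of_eq (Finset.sum_congr rfl fun ε _ => ?_)) h
  rw [reTraceForm_dyad_conjTranspose_mul_self, EuclideanSpace.norm_sq_eq]
  congr 2
  refine Finset.sum_congr rfl fun r _ => ?_
  congr 2
  simp [a, mulVec, dotProduct, signVec, mul_comm]

lemma reTraceForm_dyad_maximallyMixed (x : Fin m → ℂ) :
    reTraceForm m 1 (dyad x) (maximallyMixed m) = (∑ k, ‖x k‖ ^ 2) / m := by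
  rw [reTraceForm_apply, maximallyMixed_eq, mul_smul_comm, Matrix.mul_one, trace_smul, dyad,
    trace_vecMulVec_star_self, Complex.real_smul, ← Complex.ofReal_mul, Complex.ofReal_re]
  ring

lemma reTraceForm_dyad_self (x : Fin m → ℂ) :
    reTraceForm m 1 (dyad x) (dyad x) = (∑ k, ‖x k‖ ^ 2) ^ 2 := by
  have h : star x ⬝ᵥ x = ((∑ k, ‖x k‖ ^ 2 : ℝ) : ℂ) := by
    rw [← trace_vecMulVec_star_self, trace_vecMulVec, dotProduct_comm]
  rw [reTraceForm_apply, one_mul, dyad, trace_vecMulVec_mul, vecMulVec_mulVec, h]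
  rw [op_smul_eq_smul, dotProduct_smul, h, smul_eq_mul, ← Complex.ofReal_mul, Complex.ofReal_re, sq]

theorem exp_le_of_polytope_between (hm : m ≠ 0) {N : ℕ} {P : Set (Matrix (Fin m) (Fin m) ℂ)}
    (hP : IsPolytope P) (hN : (vertexSet P).encard = N) (h1 : quantumStates m ⊆ P)
    (h2 : P ⊆ AffineMap.homothety (maximallyMixed m) (4 : ℝ) '' quantumStates m) :
    Real.exp ((m : ℝ) / 16 - 1 / 2) ≤ N := by
  have hmpos : (0 : ℝ) < m := by positivity
  obtain ⟨hfin, hPV⟩ := hP.eq_convexHull_vertexSet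
  have hVP : vertexSet P ⊆ P := extremePoints_subset
  set V := hfin.toFinset
  have hVcard : V.card = N := by
    rw [hfin.encard_eq_coe_toFinset_card] at hN
    exact_mod_cast hN
  set q : Matrix (Fin m) (Fin m) ℂ → Matrix (Fin m) (Fin m) ℂ :=
    fun v => maximallyMixed m + (4 : ℝ)⁻¹ • (v - maximallyMixed m)
  have hq : ∀ v ∈ V, q v ∈ quantumStates m := fun v hv =>
    (mem_homothety_image_iff (by norm_num)).1 (h2 (hVP (hfin.mem_toFinset.1 hv)))
  have hex : ∀ ε : Fin m → Bool, ∃ v ∈ V,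
      (m : ℝ) / 4 ≤ reTraceForm m 1 (dyad (signVec ε)) (q v) := by
    intro ε
    have hs := sum_norm_sq_signVec ε
    set l := reTraceForm m 1 (dyad (signVec ε))
    have hne : signVec ε ≠ 0 := by
      intro h
      rw [h] at hs
      simp at hs
      exact hmpos.ne hs
    have hp := pureState_mem hne
    have hlp : l ((∑ k, ‖signVec ε k‖ ^ 2)⁻¹ • vecMulVec (signVec ε) (star (signVec ε))) = m := by
      rw [map_smul]
      change _ • l (dyad (signVec ε)) = _
      rw [reTraceForm_dyad_self, hs, smul_eq_mul]
      field_simp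
    obtain ⟨v, hv, hlv⟩ : ∃ v ∈ vertexSet P, (m : ℝ) ≤ l v := by
      by_contra! hcon
      have hsub : convexHull ℝ (vertexSet P) ⊆ {x | l x < m} :=
        convexHull_min hcon (convex_halfSpace_lt l.isLinear _)
      rw [← hPV] at hsub
      have : l _ < m := hsub (h1 hp)
      exact this.ne hlp
    refine ⟨v, hfin.mem_toFinset.2 hv, ?_⟩
    -- Hence `l (q v) ≥ 1 + (m - 1)/4 ≥ m/4`.
    have ho : l (maximallyMixed m) = 1 := by
      rw [reTraceForm_dyad_maximallyMixed, hs, div_self hmpos.ne']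
    simp only [q, map_add, map_smul, map_sub, ho, smul_eq_mul]
    linarith
  have hsum : (2 : ℝ) ^ m * Real.exp (m / 16) ≤ N * (2 ^ m * Real.exp (1 / 2)) := calc
    (2 : ℝ) ^ m * Real.exp (m / 16) = ∑ _ε : Fin m → Bool, Real.exp (m / 16) := by simp
    _ ≤ ∑ ε : Fin m → Bool, ∑ v ∈ V,
        Real.exp (1 / 4 * reTraceForm m 1 (dyad (signVec ε)) (q v)) := by
      refine Finset.sum_le_sum fun ε _ => ?_
      obtain ⟨v, hv, hle⟩ := hex ε
      refine le_trans ?_ (Finset.single_le_sum (f := fun v =>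
        Real.exp (1 / 4 * reTraceForm m 1 (dyad (signVec ε)) (q v)))
        (fun _ _ => (Real.exp_pos _).le) hv)
      exact Real.exp_le_exp.2 (by linarith)
    _ = ∑ v ∈ V, ∑ ε : Fin m → Bool,
        Real.exp (1 / 4 * reTraceForm m 1 (dyad (signVec ε)) (q v)) := Finset.sum_comm
    _ ≤ ∑ v ∈ V, 2 ^ m * Real.exp (1 / 2) :=
      Finset.sum_le_sum fun v hv => sum_exp_reTraceForm_signVec_le (hq v hv)
    _ = N * (2 ^ m * Real.exp (1 / 2)) := by rw [Finset.sum_const, hVcard, nsmul_eq_mul]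
  rw [Real.exp_sub, div_le_iff₀ (Real.exp_pos _)]
  rw [mul_left_comm] at hsum
  exact le_of_mul_le_mul_left hsum (by positivity)

/-- Serves small `m`, where the exponential bound is too weak. -/
lemma two_le_of_polytope_between (hm : 2 ≤ m) {N : ℕ} {P : Set (Matrix (Fin m) (Fin m) ℂ)}
    (hP : IsPolytope P) (hN : (vertexSet P).encard = N) (h1 : quantumStates m ⊆ P) : 2 ≤ N := by
  by_contra! hlt
  have hle : (vertexSet P).encard ≤ 1 := by
    rw [hN]; exact_mod_cast Nat.lt_succ_iff.1 hlt
  have hsub := Set.encard_le_one_iff_subsingleton.1 hle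
  have hPs : P.Subsingleton := by
    rw [hP.eq_convexHull_vertexSet.2]
    rcases hsub.eq_empty_or_singleton with h | ⟨v, h⟩ <;> rw [h] <;> simp
  let i : Fin m := ⟨0, by omega⟩
  let j : Fin m := ⟨1, by omega⟩
  have hij : j ≠ i := by simp [i, j]
  have hx : (Pi.single i 1 : Fin m → ℂ) ≠ 0 := by simp
  have heq := hPs (h1 (pureState_mem hx)) (h1 (maximallyMixed_mem (by omega)))
  have := congrFun (congrFun heq j) j
  have hm0 : m ≠ 0 := by omega
  simp [vecMulVec_apply, maximallyMixed, hij] at this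
  exact hm0 (by exact_mod_cast this.symm)

end LowerBound

theorem mainTheorem5 :
    ∃ c C : ℝ, 0 < c ∧ 0 < C ∧ ∀ m : ℕ, 2 ≤ m →
      facialDim (maximallyMixed m) (quantumStates m) 4 =
        verticialDim (maximallyMixed m) (quantumStates m) 4 ∧
      c * (m : ℝ) ≤ verticialDim (maximallyMixed m) (quantumStates m) 4 ∧
      verticialDim (maximallyMixed m) (quantumStates m) 4 ≤ C * (m : ℝ) := by
  -- For `m ≥ 16`, `m/16 - 1/2 ≥ m/32`; below 16, `m/32 < 1/2 < log 2`. The upper constant is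
  -- `log(2⁴ · 3²)`.
  refine ⟨1 / 32, 4 * Real.log 2 + 2 * Real.log 3, by norm_num, by positivity, fun m hm => ?_⟩
  have hm0 : m ≠ 0 := by omega
  refine ⟨facialDim_quantumStates_eq hm, ?_⟩
  unfold verticialDim
  set T := {N : ℕ | ∃ P : Set (Matrix (Fin m) (Fin m) ℂ), IsPolytope P ∧
    (vertexSet P).encard = N ∧ quantumStates m ⊆ P ∧
    P ⊆ AffineMap.homothety (maximallyMixed m) (4 : ℝ) '' quantumStates m}
  obtain ⟨N, hN, hNT⟩ := exists_polytope_between hm0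
  -- Nonemptiness of `T` excludes the default value `sInf ∅ = 0`, so the infimum is attained.
  obtain ⟨P, hP, hcard, h1, h2⟩ : sInf T ∈ T := Nat.sInf_mem ⟨N, hNT⟩
  have htwo : (2 : ℝ) ≤ (sInf T : ℕ) := by
    exact_mod_cast two_le_of_polytope_between hm hP hcard h1
  constructor
  · rcases lt_or_ge m 16 with hlt | hge
    · have hlog := Real.log_le_log (by norm_num) htwo
      have hlt' : (m : ℝ) < 16 := by exact_mod_cast hlt
      linarith [Real.log_two_gt_d9]
    · have hlog := Real.log_le_log (Real.exp_pos _) (exp_le_of_polytope_between hm0 hP hcard h1 h2)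
      rw [Real.log_exp] at hlog
      have hge' : (16 : ℝ) ≤ m := by exact_mod_cast hge
      linarith
  · have hle : ((sInf T : ℕ) : ℝ) ≤ 2 ^ (4 * m) * 3 ^ (2 * m) := by
      exact_mod_cast (Nat.sInf_le (show N ∈ T from hNT)).trans hN
    have hlog := Real.log_le_log (by linarith) hle
    rw [Real.log_mul (by positivity) (by positivity), Real.log_pow, Real.log_pow] at hlog
    push_cast at hlog
    linarith
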